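/- **Setting.** Let $r\ge 2$, $N\ge 2$, $\mathcal S=\{0,1,\dots,r-1\}$, and let $\mathcal B\subseteq \mathcal S^{\mathbb Z_{N\times N}}$ be any set of $N\times N$ patterns (first coordinate horizontal, second vertical). All logarithms take values in $[-\infty,\infty)$, with $\log 0=-\infty$, and $(n,k)\to\infty$ means that both $n\to\infty$ and $k\to\infty$. A pattern is called $\mathcal B$-admissible if all its $N\times N$ blocks belong to $\mathcal B$. - *Spatial entropy.* $h(\mathcal B)=\lim_{(n,k)\to\infty}\frac1{nk}\log|\Sigma_{n\times k}(\mathcal B)|$, where $\Sigma_{n\times k}(\mathcal B)$ is the set of $\mathcal B$-admissible patterns on the $n\times k$ lattice. - *Periodic entropy in a skew coordinate system.* For $\gamma=\begin{bmatrix}a&b\\c&d\end{bmatrix}\in GL_2(\mathbb Z)$ write $(x,y)_\gamma=x(a,b)+y(c,d)$. For $M,K\ge1$ and $0\le L\le M-1$ let $\Gamma_{\mathcal B}\left(\begin{bmatrix}M&L\\0&K\end{bmatrix}_\gamma\right)$ be the number of $\mathcal B$-admissible patterns $U\in\mathcal S^{\mathbb Z^2}$ with $U_{p+(Ms+Lt,\,Kt)_\gamma}=U_p$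 for all $p\in\mathbb Z^2$ and $s,t\in\mathbb Z$. Put $$h_{\gamma,p}(\mathcal B)=\limsup_{(M,K)\to\infty}\ \sup_{0\le L\le M-1}\frac1{MK}\log\Gamma_{\mathcal B}\left(\begin{bmatrix}M&L\\0&K\end{bmatrix}_\gamma\right).$$ - *Horizontal-periodic transition matrices.* For $m\ge1$ let $\mathbf T_m(\mathcal B)$ be the $0$-$1$ matrix indexed by the patterns of horizontal period $m$ and height $N-1$ (for $N=2$, the $r^m$ rows of length $m$), whose $(u,v)$ entry is $1$ if and only if $u$ and $v$ are the lower and the upper $N-1$ rows of a $\mathcal B$-admissible pattern of horizontal period $m$ and height $N$. Let $\rho(\mathbf T_m(\mathcal B))$ be its maximum eigenvalue, and $$h_*(\mathcal B)=\limsup_{m\to\infty}\frac1m\log\rho(\mathbf T_m(\mathcal B)).$$ - *Uniform domination.* Write $|A|$ for the sum of the entries of a non-negative matrix $A$. The sequence $\{\mathbf T_m(\mathcal B)\}_{m\ge1}$ is uniformly dominated by $\{\rho(\mathbf T_m(\mathcal B))\}_{m\ge1}$ if there is a positive function $c(m,k)$ with $|\mathbf T_m(\mathcal B)^k|\le c(m,k)\,\rho(\mathbf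 T_m(\mathcal B))^k$ for all $m,k\ge1$ and $\lim_{(m,k)\to\infty}\frac1{mk}\log c(m,k)=0$. **Theorem.** The limit defining $h(\mathcal B)$ exists in $[-\infty,\infty)$. If $h(\mathcal B)=h_*(\mathcal B)$, then $h_{\gamma,p}(\mathcal B)=h(\mathcal B)$ for every $\gamma\in GL_2(\mathbb Z)$. In particular, if $\{\mathbf T_m(\mathcal B)\}_{m\ge1}$ is uniformly dominated by $\{\rho(\mathbf T_m(\mathcal B))\}_{m\ge1}$, then $h_{\gamma,p}(\mathcal B)=h(\mathcal B)$ for every $\gamma\in GL_2(\mathbb Z)$. -/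

import Mathlib

open Filter Topology

noncomputable section

/-- The `N × N` patterns over the alphabet `{0, …, r - 1}`.  In every pattern the first coordinate
is horizontal and the second one is vertical. -/
abbrev LocalPattern (r N : ℕ) : Type := Fin N → Fin N → Fin r

/-- `Σ_{n × k}(B)`: the patterns on the `n × k` lattice all of whose `N × N` blocks lie in `B`. -/
def admissiblePatterns {r N : ℕ} (B : Set (LocalPattern r N)) (n k : ℕ) :
    Set (Fin n → Fin k → Fin r) :=
  {u | ∀ (i j : ℕ) (hi : i + N ≤ n) (hj : j + N ≤ k),
    (fun a b : Fin N => u ⟨i + a, by omega⟩ ⟨j + b, by omega⟩) ∈ B}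

/-- `(1 / (n k)) log |Σ_{n × k}(B)|`, in the extended reals, with `log 0 = -∞`. -/
def patternRate {r N : ℕ} (B : Set (LocalPattern r N)) (q : ℕ × ℕ) : EReal :=
  ENNReal.log ((admissiblePatterns B q.1 q.2).ncard : ENNReal) / ((q.1 : EReal) * (q.2 : EReal))

/-- The spatial entropy `h(B)`: the limit of `patternRate B` as both side lengths tend to infinity.
It is written as an upper limit, which is always defined; where the limit exists they agree. -/
def spatialEntropy {r N : ℕ} (B : Set (LocalPattern r N)) : EReal :=
  limsup (patternRate B) (atTop ×ˢ atTop)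

/-- `Σ(B)`: the patterns on `ℤ²` all of whose `N × N` blocks lie in `B`. -/
def globalPatterns {r N : ℕ} (B : Set (LocalPattern r N)) : Set (ℤ × ℤ → Fin r) :=
  {U | ∀ i j : ℤ, (fun a b : Fin N => U (i + (a : ℕ), j + (b : ℕ))) ∈ B}

/-- The lattice point `(x, y)_γ = x (a, b) + y (c, d)`, where `(a, b)` and `(c, d)` are the rows
of `γ`. -/
def skewPoint (γ : Matrix.GeneralLinearGroup (Fin 2) ℤ) (x y : ℤ) : ℤ × ℤ :=
  (x * γ.1 0 0 + y * γ.1 1 0, x * γ.1 0 1 + y * γ.1 1 1)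

/-- The patterns in `Σ(B)` that are periodic with respect to the lattice `[M, L; 0, K]_γ ℤ²`, that
is, invariant under the translations by `(M s + L t, K t)_γ` for all integers `s`, `t`. -/
def periodicPatterns {r N : ℕ} (B : Set (LocalPattern r N))
    (γ : Matrix.GeneralLinearGroup (Fin 2) ℤ) (M L K : ℕ) : Set (ℤ × ℤ → Fin r) :=
  {U | U ∈ globalPatterns B ∧
    ∀ (p : ℤ × ℤ) (s t : ℤ), U (p + skewPoint γ (M * s + L * t) (K * t)) = U p}

/-- The periodic entropy `h_{γ,p}(B)`: the upper limit, as both `M` and `K` tend to infinity, of the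
supremum over `0 ≤ L ≤ M - 1` of `(1 / (M K)) log Γ_B([M, L; 0, K]_γ)`, where `Γ_B` is the number of
periodic patterns (it is finite for `M, K ≥ 1`). -/
def skewPeriodicEntropy {r N : ℕ} (B : Set (LocalPattern r N))
    (γ : Matrix.GeneralLinearGroup (Fin 2) ℤ) : EReal :=
  limsup (fun q : ℕ × ℕ => ⨆ L : Fin q.1,
    ENNReal.log ((periodicPatterns B γ q.1 L q.2).ncard : ENNReal) /
      ((q.1 : EReal) * (q.2 : EReal))) (atTop ×ˢ atTop)

/-- The patterns of horizontal period `m` and height `N` all of whose `N × N` blocks lie in `B`; the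
blocks wrap around in the horizontal direction. -/
def cylinderPatterns {r N : ℕ} (B : Set (LocalPattern r N)) (m : ℕ) :
    Set (Fin m → Fin N → Fin r) :=
  {w | ∀ i : Fin m,
    (fun a b : Fin N => w ⟨((i : ℕ) + a) % m, Nat.mod_lt _ i.pos⟩ b) ∈ B}

open Classical in
/-- The horizontal-periodic transition matrix `T_m(B)`.  Its indices are the patterns of horizontal
period `m` and height `N - 1` (for `N = 2`: the `r ^ m` rows of length `m`), and the entry at
`(u, v)` is `1` if `u` and `v` are the lower and the upper `N - 1` rows of a `B`-admissible pattern
of horizontal period `m` and height `N`, and `0` otherwise. -/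
def transitionMatrix {r N : ℕ} (B : Set (LocalPattern r N)) (m : ℕ) :
    Matrix (Fin m → Fin (N - 1) → Fin r) (Fin m → Fin (N - 1) → Fin r) ℝ :=
  Matrix.of fun u v =>
    if ∃ w ∈ cylinderPatterns B m, ∀ (i : Fin m) (b : Fin (N - 1)),
        w i ⟨b, by omega⟩ = u i b ∧ w i ⟨b + 1, by omega⟩ = v i b
    then 1 else 0

/-- The maximum eigenvalue `ρ(A)`: the largest real eigenvalue. -/
def maxEigenvalue {ι : Type} [Fintype ι] [DecidableEq ι] (A : Matrix ι ι ℝ) : ℝ :=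
  sSup {x : ℝ | Module.End.HasEigenvalue (Matrix.toLin' A) x}

/-- `|A|`: the sum of the entries of a (non-negative) matrix. -/
def entrySum {ι : Type} [Fintype ι] (A : Matrix ι ι ℝ) : ℝ := ∑ i, ∑ j, A i j

/-- `h_*(B) = limsup_m (1 / m) log ρ(T_m(B))`, with `log 0 = -∞`. -/
def cylinderEntropy {r N : ℕ} (B : Set (LocalPattern r N)) : EReal :=
  limsup (fun m : ℕ =>
    ENNReal.log (ENNReal.ofReal (maxEigenvalue (transitionMatrix B m))) / (m : EReal)) atTop

/-- `{T_m(B)}` is uniformly dominated by `{ρ(T_m(B))}`. -/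
def UniformlyDominated {r N : ℕ} (B : Set (LocalPattern r N)) : Prop :=
  ∃ c : ℕ → ℕ → ℝ,
    (∀ m k : ℕ, 1 ≤ m → 1 ≤ k → 0 < c m k ∧
      entrySum (transitionMatrix B m ^ k) ≤ c m k * maxEigenvalue (transitionMatrix B m) ^ k) ∧
    Tendsto (fun q : ℕ × ℕ => Real.log (c q.1 q.2) / ((q.1 : ℝ) * (q.2 : ℝ)))
      (atTop ×ˢ atTop) (𝓝 0)

end

/-!
For every `γ` the inequalities `cylinderEntropy B ≤ skewPeriodicEntropy B γ ≤ spatialEntropy B`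
hold without any hypothesis on `B`. If the two outer quantities agree, so does the middle one, and
uniform domination yields the missing inequality `spatialEntropy B ≤ cylinderEntropy B`.

*The limit.* If some `Σ_{n × k}(B)` is empty, so are all larger ones and all quantities are `-∞`.
Otherwise `log |Σ_{n × k}(B)|` is subadditive in each side length, and Fekete's lemma in two
variables (`exists_tendsto_div_of_subadditive`) gives the limit, which is an infimum.

*Upper bound.* A periodic pattern is determined by its restrictions to the squares of a tiling that
meet a fundamental parallelogram of the period lattice. For squares of a fixed size and parallelograms
with both sides growing, the total area of these squares is asymptotic to that of the parallelogram
(`exists_ncard_periodicPatterns_le`).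

*Traces.* The number of closed walks of length `j` in a finite directed graph is a power sum of the
eigenvalues of its matrix `A`. By recurrence on a torus the arguments of the `j`-th powers of all
eigenvalues are simultaneously close to `0` for infinitely many `j`, so along these `j` the trace of
`A ^ j` grows as fast as the spectral radius allows (`frequently_pow_le_trace_pow`). No
Perron–Frobenius theory is needed.

*Lower bound.* Closed walks of length `k` in the transfer graph of `T_m(B)` are patterns with periods
`(m, 0)` and `(0, k)`. When `k` is a suitable multiple of `m`, the lattice `m ℤ × k ℤ` has a normal
form `[M, L; 0, K]_γ` with both `M` and `K` at least `m` (`exists_skew_sublattice`), so the trace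
bound for a power of `T_m(B)` gives `cylinderEntropy B ≤ skewPeriodicEntropy B γ`.

*Uniform domination.* The patterns on the horizontal strip of height `k + N - 1` form a
one-dimensional shift of finite type, whose transfer matrix `stripMatrix` has entry sums growing at
least like `exp (h k n)`, where `h` is the spatial entropy. By Gelfand's formula and the trace bound
it has, for infinitely many `m`, almost `exp (h k m)` closed walks of length `m`. These are patterns
on the cylinder of circumference `m`, so their number is at most `|T_m(B) ^ k|`, which uniform
domination bounds by `ρ(T_m(B)) ^ k` up to a subexponential factor.
-/

/-! ### Traces of powers of a real matrix -/

/-- The trace of `f ^ j` is the `j`-th power sum of the eigenvalues, the eigenvalue `μ` being counted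
with the dimension of its generalized eigenspace. -/
theorem exists_trace_pow_eq_sum {V : Type*} [AddCommGroup V] [Module ℂ V] [FiniteDimensional ℂ V]
    (f : Module.End ℂ V) :
    ∃ (s : Finset ℂ) (d : ℂ → ℕ), (∀ μ ∈ s, 1 ≤ d μ) ∧ (∀ μ, f.HasEigenvalue μ → μ ∈ s) ∧
      ∀ j : ℕ, LinearMap.trace ℂ V (f ^ j) = ∑ μ ∈ s, (d μ : ℂ) * μ ^ j := by
  classical
  have hds := DirectSum.isInternal_submodule_of_iSupIndep_of_iSup_eq_top
    f.independent_maxGenEigenspace (Module.End.iSup_maxGenEigenspace_eq_top f)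
  have hfin : {μ | f.maxGenEigenspace μ ≠ ⊥}.Finite :=
    WellFoundedGT.finite_ne_bot_of_iSupIndep f.independent_maxGenEigenspace
  refine ⟨hfin.toFinset, fun μ => Module.finrank ℂ (f.maxGenEigenspace μ), ?_, ?_, ?_⟩
  · intro μ hμ
    rw [Set.Finite.mem_toFinset] at hμ
    exact Submodule.one_le_finrank_iff.mpr hμ
  · intro μ hμ
    rw [Set.Finite.mem_toFinset]
    intro hbot
    refine hμ (le_bot_iff.mp ?_)
    rw [← hbot]
    exact f.genEigenspace μ |>.monotone le_top
  · intro j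
    have hmaps : ∀ μ, Set.MapsTo (f ^ j) (f.maxGenEigenspace μ) (f.maxGenEigenspace μ) :=
      fun μ => f.mapsTo_maxGenEigenspace_of_comm (Commute.pow_right (Commute.refl f) j) μ
    rw [LinearMap.trace_eq_sum_trace_restrict' hds hfin hmaps]
    refine Finset.sum_congr rfl fun μ _ => ?_
    have h1 : Set.MapsTo f (f.maxGenEigenspace μ) (f.maxGenEigenspace μ) :=
      f.mapsTo_maxGenEigenspace_of_comm (Commute.refl f) μ
    have hres : (f ^ j).restrict (hmaps μ) = (f.restrict h1) ^ j :=
      (Module.End.pow_restrict j h1 (hmaps μ)).symm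
    rw [hres]
    clear hres hmaps
    have hnil := f.isNilpotent_restrict_maxGenEigenspace_sub_algebraMap μ
    induction j with
    | zero => simp
    | succ j ih =>
      rw [pow_succ, Module.End.mul_eq_comp,
        LinearMap.trace_comp_eq_mul_of_commute_of_isNilpotent μ
          (Commute.pow_left (Commute.refl _) j) hnil, ih]
      ring

/-- Recurrence on a torus: the arguments of finitely many complex numbers return simultaneously
close to `0` along infinitely many powers. -/
theorem frequently_half_norm_pow_le_re {ι : Type*} [Finite ι] (z : ι → ℂ) :
    ∃ᶠ j : ℕ in atTop, ∀ i, ‖z i‖ ^ j / 2 ≤ (z i ^ j).re := by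
  cases nonempty_fintype ι
  have hc := mapClusterPt_one_atTop_pow (fun i => Circle.exp (z i).arg)
  have hU : {v : ι → Circle | ∀ i, 1 / 2 < ((v i : Circle) : ℂ).re} ∈ 𝓝 (1 : ι → Circle) := by
    have ho : IsOpen {v : ι → Circle | ∀ i, 1 / 2 < ((v i : Circle) : ℂ).re} := by
      simp only [Set.ofPred_forall]
      exact isOpen_iInter_of_finite fun i => isOpen_lt (by fun_prop) (by fun_prop)
    refine ho.mem_nhds fun i => ?_
    norm_num
  refine (hc.frequently hU).mono fun j hj i => ?_
  have h1 := hj i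
  have h2 : z i ^ j = ((‖z i‖ ^ j : ℝ) : ℂ) * ((Circle.exp (z i).arg ^ j : Circle) : ℂ) := by
    conv_lhs => rw [← Complex.norm_mul_exp_arg_mul_I (z i)]
    rw [mul_pow]
    push_cast
    rfl
  rw [h2, Complex.re_ofReal_mul]
  simp only [Pi.pow_apply] at h1
  have h3 : (0 : ℝ) ≤ ‖z i‖ ^ j := by positivity
  nlinarith

/-- A complex eigenvalue of a real matrix is a lower bound, along infinitely many powers, for the
growth of the trace. -/
theorem frequently_pow_le_trace_pow {ι : Type*} [Fintype ι] [DecidableEq ι] (A : Matrix ι ι ℝ)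
    {z : ℂ} (hz : z ∈ spectrum ℂ (A.map Complex.ofRealHom)) {y : ℝ} (hy : 0 < y) (hyz : y < ‖z‖) :
    ∃ᶠ j : ℕ in atTop, y ^ j ≤ (A ^ j).trace := by
  set f := Matrix.toLin' (A.map Complex.ofRealHom) with hf
  obtain ⟨s, d, hd, hs, htr⟩ := exists_trace_pow_eq_sum f
  have hzs : z ∈ s := by
    refine hs z ?_
    rw [Module.End.hasEigenvalue_iff_mem_spectrum, hf]
    rwa [Matrix.spectrum_toLin']
  have hrec := frequently_half_norm_pow_le_re (fun μ : s => (μ : ℂ))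
  have hev : ∀ᶠ j : ℕ in atTop, y ^ j ≤ ‖z‖ ^ j / 2 := by
    have hlim := tendsto_pow_atTop_nhds_zero_of_lt_one (r := y / ‖z‖)
      (by positivity) ((div_lt_one (hy.trans hyz)).mpr hyz)
    filter_upwards [hlim.eventually (gt_mem_nhds (show (0 : ℝ) < 1 / 2 by norm_num))] with j hj
    rw [div_pow, div_lt_iff₀ (pow_pos (hy.trans hyz) j)] at hj
    linarith
  refine (hrec.and_eventually hev).mono fun j ⟨hj, hyj⟩ => hyj.trans ?_
  have hA : ((A ^ j).trace : ℂ) = ∑ μ ∈ s, (d μ : ℂ) * μ ^ j := by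
    rw [← htr j, hf, ← Matrix.toLin'_pow, Matrix.trace_toLin'_eq]
    rw [← Matrix.map_pow]
    simp [Matrix.trace]
  have hre : (A ^ j).trace = ∑ μ ∈ s, (d μ : ℝ) * (μ ^ j).re := by
    have := congrArg Complex.re hA
    rw [Complex.ofReal_re, Complex.re_sum] at this
    rw [this]
    refine Finset.sum_congr rfl fun μ _ => ?_
    rw [← Complex.ofReal_natCast, Complex.re_ofReal_mul]
  have hterm : ∀ μ ∈ s, ‖μ‖ ^ j / 2 ≤ (μ ^ j).re := fun μ hμ => hj ⟨μ, hμ⟩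
  have hpos : ∀ μ ∈ s, 0 ≤ (μ ^ j).re := fun μ hμ => le_trans (by positivity) (hterm μ hμ)
  rw [hre]
  calc ‖z‖ ^ j / 2 ≤ (z ^ j).re := hterm z hzs
    _ ≤ (d z : ℝ) * (z ^ j).re :=
      le_mul_of_one_le_left (hpos z hzs) (by exact_mod_cast hd z hzs)
    _ ≤ ∑ μ ∈ s, (d μ : ℝ) * (μ ^ j).re :=
      Finset.single_le_sum (f := fun μ => (d μ : ℝ) * (μ ^ j).re)
        (fun μ hμ => mul_nonneg (Nat.cast_nonneg _) (hpos μ hμ)) hzs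

theorem frequently_pow_le_trace_pow_of_hasEigenvalue {ι : Type*} [Fintype ι] [DecidableEq ι]
    (A : Matrix ι ι ℝ) {x y : ℝ} (hx : Module.End.HasEigenvalue (Matrix.toLin' A) x)
    (hy : 0 < y) (hyx : y < x) :
    ∃ᶠ j : ℕ in atTop, y ^ j ≤ (A ^ j).trace := by
  refine frequently_pow_le_trace_pow A (z := (x : ℂ)) ?_ hy ?_
  · rw [Module.End.hasEigenvalue_iff_mem_spectrum, Matrix.spectrum_toLin',
      Matrix.mem_spectrum_iff_isRoot_charpoly] at hx
    rw [Matrix.mem_spectrum_iff_isRoot_charpoly, Matrix.charpoly_map]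
    exact hx.map
  · rw [Complex.norm_real, Real.norm_eq_abs]
    exact hyx.trans_le (le_abs_self x)

section Gelfand

attribute [local instance] Matrix.linftyOpNormedRing Matrix.linftyOpNormedAlgebra

/-- The exponential growth rate of the sum of the entries of `A ^ n` is attained by the trace along
infinitely many powers, because both are governed by the spectral radius. -/
theorem frequently_pow_le_trace_pow_of_entrySum {ι : Type} [Fintype ι] [DecidableEq ι]
    (A : Matrix ι ι ℝ) {x y : ℝ} (hx : ∀ n : ℕ, x ^ n ≤ entrySum (A ^ n))
    (hy : 0 < y) (hyx : y < x) :
    ∃ᶠ j : ℕ in atTop, y ^ j ≤ (A ^ j).trace := by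
  have hι : Nonempty ι := by
    by_contra h
    rw [not_nonempty_iff] at h
    have := hx 0
    simp [entrySum] at this
    linarith
  set C := A.map Complex.ofRealHom with hC
  obtain ⟨z, hz, hzr⟩ := spectrum.exists_nnnorm_eq_spectralRadius C
  refine frequently_pow_le_trace_pow A hz hy (hyx.trans_le ?_)
  have hx0 : 0 < x := hy.trans hyx
  have hbound : ∀ n : ℕ, x ^ n ≤ Fintype.card ι * ‖C ^ n‖ := by
    intro n
    refine (hx n).trans ?_
    unfold entrySum
    rw [← nsmul_eq_mul, ← Finset.card_univ]
    refine Finset.sum_le_card_nsmul _ _ _ fun i _ => ?_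
    rw [Matrix.linfty_opNorm_def]
    calc ∑ j, (A ^ n) i j ≤ ∑ j, ‖(C ^ n) i j‖ := by
          refine Finset.sum_le_sum fun j _ => ?_
          rw [hC, ← Matrix.map_pow, Matrix.map_apply, Complex.ofRealHom_eq_coe, Complex.norm_real]
          exact le_abs_self _
      _ = ((∑ j, ‖(C ^ n) i j‖₊ : NNReal) : ℝ) := by push_cast; rfl
      _ ≤ _ := by
          exact_mod_cast Finset.le_sup (f := fun i => ∑ j, ‖(C ^ n) i j‖₊) (Finset.mem_univ i)
  have hG := spectrum.pow_norm_pow_one_div_tendsto_nhds_spectralRadius C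
  rw [← hzr] at hG
  have hcard : (0 : ℝ) < Fintype.card ι := by exact_mod_cast Fintype.card_pos
  have hlow : Tendsto (fun n : ℕ => ENNReal.ofReal (x * (Fintype.card ι : ℝ)⁻¹ ^ (1 / n : ℝ))) atTop
      (𝓝 (ENNReal.ofReal x)) := by
    refine ENNReal.tendsto_ofReal ?_
    have h1 : Tendsto (fun n : ℕ => (1 / n : ℝ)) atTop (𝓝 0) := tendsto_one_div_atTop_nhds_zero_nat
    have h2 := ((Real.continuousAt_const_rpow (a := (Fintype.card ι : ℝ)⁻¹) (b := 0)
      (by positivity)).tendsto.comp h1).const_mul x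
    rw [Real.rpow_zero, mul_one] at h2
    exact h2
  have hle : ENNReal.ofReal x ≤ (‖z‖₊ : ENNReal) := by
    refine le_of_tendsto_of_tendsto hlow hG ?_
    filter_upwards [eventually_ge_atTop 1] with n hn
    refine ENNReal.ofReal_le_ofReal ?_
    have hn0 : (n : ℝ) ≠ 0 := by positivity
    have h3 : x ^ n * (Fintype.card ι : ℝ)⁻¹ ≤ ‖C ^ n‖ := by
      rw [← div_eq_mul_inv, div_le_iff₀ hcard, mul_comm]
      exact hbound n
    calc x * (Fintype.card ι : ℝ)⁻¹ ^ (1 / n : ℝ)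
        = (x ^ n * (Fintype.card ι : ℝ)⁻¹) ^ (1 / n : ℝ) := by
          rw [Real.mul_rpow (by positivity) (by positivity), ← Real.rpow_natCast, ← Real.rpow_mul
            hx0.le, mul_one_div_cancel hn0, Real.rpow_one]
      _ ≤ _ := Real.rpow_le_rpow (by positivity) h3 (by positivity)
  rw [← enorm_eq_nnnorm, ← ofReal_norm, ENNReal.ofReal_le_ofReal_iff (norm_nonneg z)] at hle
  exact hle

end Gelfand

/-! ### Walks and one-dimensional shifts of finite type -/

theorem Matrix.pow_apply_eq_sum_walks {ι : Type*} [Fintype ι] [DecidableEq ι] (A : Matrix ι ι ℝ)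
    (n : ℕ) (i j : ι) :
    (A ^ n) i j = ∑ f : Fin (n + 1) → ι, if f 0 = i ∧ f (Fin.last n) = j then
      ∏ t : Fin n, A (f t.castSucc) (f t.succ) else 0 := by
  induction n generalizing i with
  | zero =>
    rw [pow_zero, Matrix.one_apply, ← (Equiv.funUnique (Fin 1) ι).symm.sum_comp]
    simp only [Equiv.funUnique_symm_apply, uniqueElim_const, Finset.univ_eq_empty,
      Finset.prod_empty]
    by_cases h : i = j
    · subst h
      simp
    · rw [if_neg h, Finset.sum_eq_zero]
      intro x _
      rw [if_neg]
      rintro ⟨rfl, rfl⟩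
      exact h rfl
  | succ n ih =>
    rw [pow_succ', Matrix.mul_apply, ← (Fin.consEquiv (fun _ : Fin (n + 2) => ι)).sum_comp,
      Fintype.sum_prod_type]
    simp only [Fin.consEquiv, Equiv.coe_fn_mk, Fin.cons_zero, Fin.prod_univ_succ, Fin.castSucc_zero,
      Fin.cons_succ, ← Fin.succ_castSucc, ← Fin.succ_last]
    symm
    rw [Finset.sum_eq_single i (fun a _ ha => by simp [ha]) (by simp)]
    simp_rw [ih, Finset.mul_sum]
    rw [Finset.sum_comm]
    refine Finset.sum_congr rfl fun f _ => ?_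
    rw [Finset.sum_eq_single (f 0) (fun a _ ha => by simp [ha.symm]) (by simp)]
    simp

open Classical in
/-- The `0`-`1` matrix of a relation. -/
noncomputable def relMatrix {ι : Type*} (R : ι → ι → Prop) : Matrix ι ι ℝ :=
  Matrix.of fun i j => if R i j then 1 else 0

theorem entrySum_relMatrix_pow {ι : Type} [Fintype ι] [DecidableEq ι] (R : ι → ι → Prop) (n : ℕ) :
    entrySum (relMatrix R ^ n) =
      ({f : Fin (n + 1) → ι | ∀ t : Fin n, R (f t.castSucc) (f t.succ)}.ncard : ℝ) := by
  classical
  have h : entrySum (relMatrix R ^ n) =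
      ∑ f : Fin (n + 1) → ι, ∏ t : Fin n, relMatrix R (f t.castSucc) (f t.succ) := by
    unfold entrySum
    simp_rw [Matrix.pow_apply_eq_sum_walks]
    rw [← Fintype.sum_prod_type', Finset.sum_comm]
    refine Finset.sum_congr rfl fun f _ => ?_
    rw [Finset.sum_eq_single (f 0, f (Fin.last n)) _ (by simp)]
    · simp
    · rintro ⟨a, b⟩ _ hab
      rw [if_neg]
      rintro ⟨rfl, rfl⟩
      exact hab rfl
  rw [h]
  simp only [relMatrix, Matrix.of_apply, Finset.prod_boole, Finset.mem_univ, true_imp_iff,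
    Finset.sum_boole]
  rw [Set.ncard_eq_toFinset_card']
  simp

theorem trace_relMatrix_pow {ι : Type*} [Fintype ι] [DecidableEq ι] (R : ι → ι → Prop) (n : ℕ) :
    (relMatrix R ^ n).trace =
      ({f : Fin (n + 1) → ι | f (Fin.last n) = f 0 ∧
        ∀ t : Fin n, R (f t.castSucc) (f t.succ)}.ncard : ℝ) := by
  classical
  have h : (relMatrix R ^ n).trace =
      ∑ f : Fin (n + 1) → ι, if f (Fin.last n) = f 0 then
        ∏ t : Fin n, relMatrix R (f t.castSucc) (f t.succ) else 0 := by
    unfold Matrix.trace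
    simp_rw [Matrix.diag_apply, Matrix.pow_apply_eq_sum_walks]
    rw [Finset.sum_comm]
    refine Finset.sum_congr rfl fun f _ => ?_
    rw [Finset.sum_eq_single (f 0) _ (by simp)]
    · simp
    · intro a _ ha
      rw [if_neg]
      rintro ⟨rfl, _⟩
      exact ha rfl
  rw [h]
  simp only [relMatrix, Matrix.of_apply, Finset.prod_boole, Finset.mem_univ, true_imp_iff,
    ← ite_and, Finset.sum_boole]
  rw [Set.ncard_eq_toFinset_card']
  simp

/-- The words of length `n` over the alphabet `X` all of whose windows of length `N` lie in `W`. -/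
def linearWords {X : Type*} {N : ℕ} (W : Set (Fin N → X)) (n : ℕ) : Set (Fin n → X) :=
  {g | ∀ (i : ℕ) (hi : i + N ≤ n), (fun b : Fin N => g ⟨i + b, by omega⟩) ∈ W}

/-- The cyclic words of length `n` all of whose windows of length `N`, which wrap around, lie
in `W`. -/
def cyclicWords {X : Type*} {N : ℕ} (W : Set (Fin N → X)) (n : ℕ) : Set (Fin n → X) :=
  {g | ∀ i : Fin n, (fun b : Fin N => g ⟨((i : ℕ) + b) % n, Nat.mod_lt _ i.pos⟩) ∈ W}

/-- `u` and `v` are the initial and the final subword of length `N - 1` of a word in `W`. -/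
def WindowStep {X : Type*} {N : ℕ} (W : Set (Fin N → X)) (u v : Fin (N - 1) → X) : Prop :=
  ∃ w ∈ W, ∀ b : Fin (N - 1), w ⟨b, by omega⟩ = u b ∧ w ⟨b + 1, by omega⟩ = v b

/-- A closed walk in the transfer graph is the sequence of windows of a cyclic word. The bijection
`e` leaves free how the vertices of the transfer graph are encoded. -/
theorem ncard_closedWalks_le_cyclicWords {X ι : Type*} [Finite X] {N : ℕ} (hN : 2 ≤ N)
    (W : Set (Fin N → X)) (e : ι ≃ (Fin (N - 1) → X)) (R : ι → ι → Prop)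
    (hR : ∀ u v, R u v → WindowStep W (e u) (e v)) {k : ℕ} (hk : 1 ≤ k) :
    {f : Fin (k + 1) → ι | f (Fin.last k) = f 0 ∧
        ∀ t : Fin k, R (f t.castSucc) (f t.succ)}.ncard ≤ (cyclicWords W k).ncard := by
  -- The periodic extension of a closed walk; the word consists of the first letters of its windows.
  let F : (Fin (k + 1) → ι) → ℕ → Fin (N - 1) → X :=
    fun f t => e (f ⟨t % k, (Nat.mod_lt _ hk).trans (Nat.lt_succ_self k)⟩)
  have hstep : ∀ f : Fin (k + 1) → ι, (f (Fin.last k) = f 0 ∧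
      ∀ t : Fin k, R (f t.castSucc) (f t.succ)) → ∀ t, WindowStep W (F f t) (F f (t + 1)) := by
    intro f hf t
    have h := hR _ _ (hf.2 ⟨t % k, Nat.mod_lt _ hk⟩)
    have h2 : e (f (Fin.succ ⟨t % k, Nat.mod_lt _ hk⟩)) = F f (t + 1) := by
      simp only [F]
      congr 1
      rcases Nat.lt_or_ge (t % k + 1) k with hlt | hge
      · congr 1
        ext
        simp only [Fin.succ_mk]
        rw [Nat.add_mod, Nat.mod_eq_of_lt (a := t % k + 1 % k)]
        · rcases Nat.lt_or_ge 1 k with h1 | h1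
          · rw [Nat.mod_eq_of_lt h1]
          · omega
        · rcases Nat.lt_or_ge 1 k with h1 | h1
          · rw [Nat.mod_eq_of_lt h1]
            exact hlt
          · omega
      · have hlt := Nat.mod_lt t hk
        have heq : t % k + 1 = k := by omega
        have h0 : (t + 1) % k = 0 := by
          rw [← Nat.mod_add_mod, heq, Nat.mod_self]
        have e1 : Fin.succ ⟨t % k, Nat.mod_lt _ hk⟩ = Fin.last k := by
          ext
          simpa using heq
        rw [e1, hf.1]
        congr 1
        ext
        simp [h0]
    rw [h2] at h
    exact h
  have hread : ∀ f : Fin (k + 1) → ι, (f (Fin.last k) = f 0 ∧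
      ∀ t : Fin k, R (f t.castSucc) (f t.succ)) → ∀ (b : ℕ) (hb : b < N - 1) (t : ℕ),
      F f t ⟨b, hb⟩ = F f (t + b) ⟨0, by omega⟩ := by
    intro f hf b
    induction b with
    | zero => intro hb t; rfl
    | succ b ih =>
      intro hb t
      obtain ⟨w, -, hw⟩ := hstep f hf t
      have h1 := (hw ⟨b + 1, hb⟩).1
      have h2 := (hw ⟨b, by omega⟩).2
      rw [← h1, h2, ih (by omega) (t + 1), show t + 1 + b = t + (b + 1) by omega]
  have hmod : ∀ f t, F f (t % k) = F f t := by
    intro f t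
    simp only [F, Nat.mod_mod]
  refine Set.ncard_le_ncard_of_injOn (fun f (t : Fin k) => F f t ⟨0, by omega⟩) ?_ ?_
    (Set.toFinite _)
  · intro f hf i
    obtain ⟨w, hwW, hw⟩ := hstep f hf i
    have : (fun b : Fin N => F f (((i : ℕ) + b) % k) ⟨0, by omega⟩) = w := by
      funext b
      rw [hmod]
      rcases Nat.lt_or_ge b (N - 1) with hb | hb
      · rw [← hread f hf b hb, ← (hw ⟨b, hb⟩).1]
      · have h2 := (hw ⟨N - 2, by omega⟩).2
        rw [hread f hf (N - 2) (by omega)] at h2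
        have hbN : (b : ℕ) = N - 2 + 1 := by omega
        have e1 : b = ⟨N - 2 + 1, by omega⟩ := Fin.ext hbN
        rw [e1, h2, show (i : ℕ) + 1 + (N - 2) = i + (N - 2 + 1) by omega]
    simp only
    rw [this]
    exact hwW
  · intro f hf f' hf' hff
    have key : ∀ t, F f t = F f' t := by
      intro t
      funext b
      rw [hread f hf b b.2, hread f' hf' b b.2, ← hmod f, ← hmod f']
      exact congrFun hff ⟨(t + b) % k, Nat.mod_lt _ hk⟩
    have key2 : ∀ t (ht : t < k), f ⟨t, by omega⟩ = f' ⟨t, by omega⟩ := by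
      intro t ht
      have h := e.injective (key t)
      simp only [Nat.mod_eq_of_lt ht] at h
      exact h
    funext t
    rcases Nat.lt_or_ge t k with ht | ht
    · exact key2 t ht
    · have : t = Fin.last k := Fin.ext (by simp; omega)
      rw [this, hf.1, hf'.1]
      exact key2 0 hk

/-- The windows of an admissible word form a walk in the transfer graph. -/
theorem ncard_linearWords_le_walks {X ι : Type*} [Finite ι] {N : ℕ} (hN : 2 ≤ N)
    (W : Set (Fin N → X)) (e : ι ≃ (Fin (N - 1) → X)) (R : ι → ι → Prop)
    (hR : ∀ u v, WindowStep W (e u) (e v) → R u v) (n : ℕ) :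
    (linearWords W (n + (N - 1))).ncard ≤
      {f : Fin (n + 1) → ι | ∀ t : Fin n, R (f t.castSucc) (f t.succ)}.ncard := by
  refine Set.ncard_le_ncard_of_injOn
    (fun g (t : Fin (n + 1)) => e.symm fun b : Fin (N - 1) => g ⟨t + b, by omega⟩) ?_ ?_
    (Set.toFinite _)
  · intro g hg t
    refine hR _ _ ⟨_, hg t (by omega), fun b => ?_⟩
    simp only [Equiv.apply_symm_apply, Fin.val_castSucc, Fin.val_succ, true_and]
    congr 2
    omega
  · intro g _ g' _ h
    funext s
    have h1 : ∀ (t : Fin (n + 1)) (b : Fin (N - 1)),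
        g ⟨t + b, by omega⟩ = g' ⟨t + b, by omega⟩ := by
      intro t b
      exact congrFun (e.symm.injective (congrFun h t)) b
    have h2 := h1 ⟨min (s : ℕ) n, by omega⟩ ⟨s - min (s : ℕ) n, by omega⟩
    have h3 : (⟨min (s : ℕ) n + (s - min (s : ℕ) n), by omega⟩ : Fin (n + (N - 1))) = s := by
      ext
      simp only
      omega
    simp only [h3] at h2
    exact h2

/-! ### Transfer matrices of strips and cylinders -/

/-- The admissible patterns on the cylinder of circumference `m` and height `N`, read as words of
`N` rows. -/
def cylinderWindows {r N : ℕ} (B : Set (LocalPattern r N)) (m : ℕ) : Set (Fin N → Fin m → Fin r) :=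
  {w | (fun i b => w b i) ∈ cylinderPatterns B m}

/-- The relation whose matrix is `transitionMatrix B m`. -/
def CylinderStep {r N : ℕ} (B : Set (LocalPattern r N)) (m : ℕ)
    (u v : Fin m → Fin (N - 1) → Fin r) : Prop :=
  WindowStep (cylinderWindows B m) (Equiv.piComm (fun _ _ => Fin r) u)
    (Equiv.piComm (fun _ _ => Fin r) v)

theorem transitionMatrix_eq_relMatrix {r N : ℕ} (B : Set (LocalPattern r N)) (m : ℕ) :
    transitionMatrix B m = relMatrix (CylinderStep B m) := by
  classical
  ext u v
  simp only [transitionMatrix, relMatrix, Matrix.of_apply]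
  refine if_congr ⟨?_, ?_⟩ rfl rfl
  · rintro ⟨w, hw, h⟩
    exact ⟨fun b i => w i b, hw, fun b => ⟨funext fun i => (h i b).1, funext fun i => (h i b).2⟩⟩
  · rintro ⟨w, hw, h⟩
    exact ⟨fun i b => w b i, hw, fun i b => ⟨congrFun (h b).1 i, congrFun (h b).2 i⟩⟩

/-- The transfer matrix of the horizontal strip of height `k`; its vertices are the patterns on the
`(N - 1) × k` lattice. -/
noncomputable def stripMatrix {r N : ℕ} (B : Set (LocalPattern r N)) (k : ℕ) :
    Matrix (Fin (N - 1) → Fin k → Fin r) (Fin (N - 1) → Fin k → Fin r) ℝ :=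
  relMatrix (WindowStep (admissiblePatterns B N k))

theorem ncard_admissiblePatterns_le_entrySum {r N : ℕ} (hN : 2 ≤ N) (B : Set (LocalPattern r N))
    (n k : ℕ) :
    ((admissiblePatterns B (n + (N - 1)) k).ncard : ℝ) ≤ entrySum (stripMatrix B k ^ n) := by
  rw [stripMatrix, entrySum_relMatrix_pow]
  refine Nat.cast_le.mpr (le_trans (Set.ncard_le_ncard ?_ (Set.toFinite _))
    (ncard_linearWords_le_walks hN (admissiblePatterns B N k) (Equiv.refl _) _ (fun _ _ h => h) n))
  intro u hu i hi i' j hi' hj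
  have h0 : i' = 0 := by omega
  subst h0
  simpa using hu i j hi hj

/-- A closed walk of length `m` in the transfer graph of the strip of height `k + N - 1` is an
admissible pattern on a cylinder, hence a walk of length `k` in the transfer graph of the cylinder
of circumference `m`. -/
theorem trace_stripMatrix_le_entrySum {r N : ℕ} (hN : 2 ≤ N) (B : Set (LocalPattern r N))
    {m : ℕ} (hm : 1 ≤ m) (k : ℕ) :
    (stripMatrix B (k + (N - 1)) ^ m).trace ≤ entrySum (transitionMatrix B m ^ k) := by
  rw [stripMatrix, trace_relMatrix_pow, transitionMatrix_eq_relMatrix, entrySum_relMatrix_pow]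
  refine Nat.cast_le.mpr ?_
  refine (ncard_closedWalks_le_cyclicWords hN (admissiblePatterns B N (k + (N - 1)))
    (Equiv.refl _) _ (fun _ _ h => h) hm).trans ?_
  refine le_trans ?_ (ncard_linearWords_le_walks hN (cylinderWindows B m)
    (Equiv.piComm (fun _ _ => Fin r)) _ (fun _ _ h => h) k)
  refine Set.ncard_le_ncard_of_injOn (fun g j i => g i j) ?_ ?_ (Set.toFinite _)
  · intro g hg j hj i
    have := hg i 0 j (by omega) hj
    simpa using this
  · intro g _ g' _ h
    funext i j
    exact congrFun (congrFun h j) i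

/-- A closed walk of length `k` in the transfer graph of the cylinder of circumference `m` is an
admissible pattern with periods `(m, 0)` and `(0, k)`. -/
theorem trace_transitionMatrix_le_ncard {r N : ℕ} (hN : 2 ≤ N) (B : Set (LocalPattern r N))
    {m k : ℕ} (hm : 1 ≤ m) (hk : 1 ≤ k) (S : Set (ℤ × ℤ → Fin r)) (hS : S.Finite)
    (hsub : ∀ U ∈ globalPatterns B, (∀ p q : ℤ × ℤ, (m : ℤ) ∣ q.1 → (k : ℤ) ∣ q.2 →
      U (p + q) = U p) → U ∈ S) :
    (transitionMatrix B m ^ k).trace ≤ (S.ncard : ℝ) := by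
  rw [transitionMatrix_eq_relMatrix, trace_relMatrix_pow]
  refine Nat.cast_le.mpr ?_
  refine (ncard_closedWalks_le_cyclicWords hN (cylinderWindows B m)
    (Equiv.piComm (fun _ _ => Fin r)) _ (fun _ _ h => h) hk).trans ?_
  have hmod : ∀ {n : ℕ} (_ : 1 ≤ n) (x : ℤ), (x % (n : ℤ)).toNat < n := by
    intro n hn x
    have h1 := Int.emod_nonneg x (b := (n : ℤ)) (by omega)
    have h2 := Int.emod_lt_of_pos x (b := (n : ℤ)) (by omega)
    omega
  have hshift : ∀ {n : ℕ} (_ : 1 ≤ n) (x : ℤ) (a : ℕ),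
      ((x + a) % (n : ℤ)).toNat = ((x % (n : ℤ)).toNat + a) % n := by
    intro n hn x a
    have h1 := Int.emod_nonneg x (b := (n : ℤ)) (by omega)
    have h2 := Int.emod_nonneg (x + a) (b := (n : ℤ)) (by omega)
    zify
    rw [Int.toNat_of_nonneg h1, Int.toNat_of_nonneg h2, Int.emod_add_emod]
  refine Set.ncard_le_ncard_of_injOn (fun g p => g ⟨(p.2 % (k : ℤ)).toNat, hmod hk p.2⟩
    ⟨(p.1 % (m : ℤ)).toNat, hmod hm p.1⟩) ?_ ?_ hS
  · intro g hg
    refine hsub _ ?_ ?_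
    · intro i j
      have h := hg ⟨(j % (k : ℤ)).toNat, hmod hk j⟩ ⟨(i % (m : ℤ)).toNat, hmod hm i⟩
      simp only [hshift hm, hshift hk]
      exact h
    · rintro ⟨p1, p2⟩ ⟨q1, q2⟩ ⟨s, hs⟩ ⟨t, ht⟩
      simp only at hs ht
      subst hs ht
      simp only [Prod.mk_add_mk, Int.add_mul_emod_self_left]
  · intro g _ g' _ h
    funext j i
    have h1 := congrFun h ((i : ℤ), (j : ℤ))
    simp only [← Int.natCast_mod, Int.toNat_natCast, Nat.mod_eq_of_lt i.2,
      Nat.mod_eq_of_lt j.2, Fin.eta] at h1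
    exact h1

/-! ### Submultiplicativity of the pattern counts -/

theorem ncard_admissiblePatterns_add_left_le {r N : ℕ} (B : Set (LocalPattern r N)) (n n' k : ℕ) :
    (admissiblePatterns B (n + n') k).ncard ≤
      (admissiblePatterns B n k).ncard * (admissiblePatterns B n' k).ncard := by
  rw [← Set.ncard_prod]
  refine Set.ncard_le_ncard_of_injOn
    (fun u => (fun i => u (Fin.castAdd n' i), fun i => u (Fin.natAdd n i))) ?_ ?_ (Set.toFinite _)
  · intro u hu
    refine ⟨fun i j hi hj => hu i j (by omega) hj, fun i j hi hj => ?_⟩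
    have h := hu (n + i) j (by omega) hj
    simp only [Fin.natAdd_mk]
    simpa only [add_assoc] using h
  · intro u _ u' _ h
    simp only [Prod.mk.injEq] at h
    funext i
    refine Fin.addCases (fun i => congrFun h.1 i) (fun i => congrFun h.2 i) i

theorem ncard_admissiblePatterns_add_right_le {r N : ℕ} (B : Set (LocalPattern r N)) (n k k' : ℕ) :
    (admissiblePatterns B n (k + k')).ncard ≤
      (admissiblePatterns B n k).ncard * (admissiblePatterns B n k').ncard := by
  rw [← Set.ncard_prod]
  refine Set.ncard_le_ncard_of_injOn
    (fun u => (fun i j => u i (Fin.castAdd k' j), fun i j => u i (Fin.natAdd k j))) ?_ ?_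
    (Set.toFinite _)
  · intro u hu
    refine ⟨fun i j hi hj => hu i j hi (by omega), fun i j hi hj => ?_⟩
    have h := hu i (k + j) hi (by omega)
    simp only [Fin.natAdd_mk]
    simpa only [add_assoc] using h
  · intro u _ u' _ h
    simp only [Prod.mk.injEq] at h
    funext i j
    refine Fin.addCases (fun j => congrFun (congrFun h.1 i) j)
      (fun j => congrFun (congrFun h.2 i) j) j

theorem ncard_admissiblePatterns_le {r N : ℕ} (B : Set (LocalPattern r N)) (n k : ℕ) :
    (admissiblePatterns B n k).ncard ≤ r ^ (n * k) := by
  refine (Set.ncard_le_card _).trans ?_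
  simp [Nat.card_eq_fintype_card, ← pow_mul, mul_comm]

/-! ### Subadditive functions of two variables -/

/-- Fekete's lemma in two variables: `f n k / (n k)` tends to its infimum. -/
theorem exists_tendsto_div_of_subadditive (f : ℕ → ℕ → ℝ) (C : ℝ) (h0 : ∀ n k, 0 ≤ f n k)
    (hC : ∀ n k : ℕ, f n k ≤ n * k * C) (hl : ∀ n n' k, f (n + n') k ≤ f n k + f n' k)
    (hr : ∀ n k k', f n (k + k') ≤ f n k + f n k') :
    ∃ h : ℝ, 0 ≤ h ∧ (∀ n k : ℕ, h * (n * k) ≤ f n k) ∧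
      Tendsto (fun q : ℕ × ℕ => f q.1 q.2 / ((q.1 : ℝ) * q.2)) (atTop ×ˢ atTop) (𝓝 h) := by
  have hC0 : 0 ≤ C := by
    have := (h0 1 1).trans (hC 1 1)
    simpa using this
  set S : Set ℝ := {x | ∃ n k : ℕ, 1 ≤ n ∧ 1 ≤ k ∧ x = f n k / ((n : ℝ) * k)} with hS
  have hSne : S.Nonempty := ⟨_, 1, 1, le_rfl, le_rfl, rfl⟩
  have hS0 : ∀ x ∈ S, 0 ≤ x := by
    rintro x ⟨n, k, -, -, rfl⟩
    exact div_nonneg (h0 n k) (by positivity)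
  have hSb : BddBelow S := ⟨0, hS0⟩
  have hle : ∀ n k : ℕ, 1 ≤ n → 1 ≤ k → sInf S ≤ f n k / ((n : ℝ) * k) :=
    fun n k hn hk => csInf_le hSb ⟨n, k, hn, hk, rfl⟩
  refine ⟨sInf S, le_csInf hSne hS0, ?_, ?_⟩
  · intro n k
    rcases Nat.eq_zero_or_pos n with rfl | hn
    · simpa using h0 0 k
    rcases Nat.eq_zero_or_pos k with rfl | hk
    · simpa using h0 n 0
    have := hle n k hn hk
    rwa [le_div_iff₀ (by positivity)] at this
  have hpos : ∀ᶠ q : ℕ × ℕ in atTop ×ˢ atTop, 1 ≤ q.1 ∧ 1 ≤ q.2 :=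
    (eventually_ge_atTop 1).prod_mk (eventually_ge_atTop 1)
  refine tendsto_order.mpr ⟨fun a ha => ?_, fun a ha => ?_⟩
  · filter_upwards [hpos] with q hq
    exact ha.trans_le (hle q.1 q.2 hq.1 hq.2)
  · obtain ⟨x, ⟨n₀, k₀, hn₀, hk₀, rfl⟩, hx⟩ := exists_lt_of_csInf_lt hSne ha
    have key : ∀ n k : ℕ, 1 ≤ n → 1 ≤ k → f n k / ((n : ℝ) * k) ≤
        f n₀ k₀ / ((n₀ : ℝ) * k₀) + (k₀ * C / k + n₀ * C / n) := by
      intro n k hn hk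
      have e1 : f n k ≤ (n / n₀ : ℕ) * f n₀ k + n₀ * k * C := by
        have h1 := Subadditive.apply_mul_add_le (u := fun n => f n k) (fun a b => hl a b k)
          (n / n₀) n₀ (n % n₀)
        rw [mul_comm (n / n₀) n₀, Nat.div_add_mod] at h1
        have h2 : f (n % n₀) k ≤ n₀ * k * C := by
          refine (hC _ _).trans ?_
          have : ((n % n₀ : ℕ) : ℝ) ≤ n₀ := by exact_mod_cast (Nat.mod_lt n hn₀).le
          gcongr
        linarith
      have e2 : f n₀ k ≤ (k / k₀ : ℕ) * f n₀ k₀ + n₀ * k₀ * C := by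
        have h1 := Subadditive.apply_mul_add_le (u := fun k => f n₀ k) (fun a b => hr n₀ a b)
          (k / k₀) k₀ (k % k₀)
        rw [mul_comm (k / k₀) k₀, Nat.div_add_mod] at h1
        have h2 : f n₀ (k % k₀) ≤ n₀ * k₀ * C := by
          refine (hC _ _).trans ?_
          have : ((k % k₀ : ℕ) : ℝ) ≤ k₀ := by exact_mod_cast (Nat.mod_lt k hk₀).le
          gcongr
        linarith
      have q1 : ((n / n₀ : ℕ) : ℝ) ≤ n / n₀ := Nat.cast_div_le
      have q2 : ((k / k₀ : ℕ) : ℝ) ≤ k / k₀ := Nat.cast_div_le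
      have hn0 : (0 : ℝ) < n := by exact_mod_cast hn
      have hk0 : (0 : ℝ) < k := by exact_mod_cast hk
      have hn00 : (0 : ℝ) < n₀ := by exact_mod_cast hn₀
      have hk00 : (0 : ℝ) < k₀ := by exact_mod_cast hk₀
      have hf := h0 n₀ k₀
      have e3 : f n k ≤ (n / n₀) * ((k / k₀) * f n₀ k₀ + n₀ * k₀ * C) + n₀ * k * C := by
        refine e1.trans (add_le_add_left ?_ _)
        refine mul_le_mul q1 (e2.trans ?_) (h0 n₀ k) (by positivity)
        gcongr
      rw [div_le_iff₀ (by positivity)]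
      refine e3.trans (le_of_eq ?_)
      field_simp
      ring
    have hlim : Tendsto (fun q : ℕ × ℕ => f n₀ k₀ / ((n₀ : ℝ) * k₀) +
        (k₀ * C / (q.2 : ℝ) + n₀ * C / (q.1 : ℝ))) (atTop ×ˢ atTop)
        (𝓝 (f n₀ k₀ / ((n₀ : ℝ) * k₀) + (0 + 0))) := by
      refine tendsto_const_nhds.add (Tendsto.add ?_ ?_)
      · exact (tendsto_const_div_atTop_nhds_zero_nat _).comp tendsto_snd
      · exact (tendsto_const_div_atTop_nhds_zero_nat _).comp tendsto_fst
    rw [add_zero, add_zero] at hlim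
    filter_upwards [hpos, hlim.eventually (gt_mem_nhds hx)] with q hq hq2
    exact (key q.1 q.2 hq.1 hq.2).trans_lt hq2

/-! ### Counting the periodic patterns of a skew lattice -/

/-- The integers are the entries of `γ⁻¹`. -/
theorem exists_skewPoint_inverse (γ : Matrix.GeneralLinearGroup (Fin 2) ℤ) :
    ∃ e f g h : ℤ, (∀ p : ℤ × ℤ, skewPoint γ (p.1 * e + p.2 * g) (p.1 * f + p.2 * h) = p) ∧
      ∀ x y : ℤ, (skewPoint γ x y).1 * e + (skewPoint γ x y).2 * g = x ∧
        (skewPoint γ x y).1 * f + (skewPoint γ x y).2 * h = y := by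
  have h1 : γ.1 * (γ⁻¹).1 = 1 := γ.mul_inv
  have h2 : (γ⁻¹).1 * γ.1 = 1 := γ.inv_mul
  have a1 := congrFun (congrFun h1 0) 0
  have a2 := congrFun (congrFun h1 0) 1
  have a3 := congrFun (congrFun h1 1) 0
  have a4 := congrFun (congrFun h1 1) 1
  have b1 := congrFun (congrFun h2 0) 0
  have b2 := congrFun (congrFun h2 0) 1
  have b3 := congrFun (congrFun h2 1) 0
  have b4 := congrFun (congrFun h2 1) 1
  simp only [Matrix.mul_apply, Fin.sum_univ_two, Matrix.one_apply, Fin.isValue, ↓reduceIte,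
    one_ne_zero, zero_ne_one] at a1 a2 a3 a4 b1 b2 b3 b4
  refine ⟨(γ⁻¹).1 0 0, (γ⁻¹).1 0 1, (γ⁻¹).1 1 0, (γ⁻¹).1 1 1, ?_, ?_⟩
  · rintro ⟨p, q⟩
    simp only [skewPoint, Prod.mk.injEq]
    constructor
    · linear_combination p * b1 + q * b3
    · linear_combination p * b2 + q * b4
  · intro x y
    simp only [skewPoint]
    constructor
    · linear_combination x * a1 + y * a3
    · linear_combination x * a2 + y * a4

/-- The points `(x, y)_γ` with `0 ≤ x < M` and `0 ≤ y < K` represent all points modulo the lattice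
`[M, L; 0, K]_γ`. -/
theorem exists_skewPoint_eq_of_periodic {r N : ℕ} (B : Set (LocalPattern r N))
    (γ : Matrix.GeneralLinearGroup (Fin 2) ℤ) {M K : ℕ} (hM : 1 ≤ M) (hK : 1 ≤ K) (L : ℕ)
    (p : ℤ × ℤ) :
    ∃ x y : ℕ, x < M ∧ y < K ∧ ∀ U ∈ periodicPatterns B γ M L K, U (skewPoint γ x y) = U p := by
  obtain ⟨e, f, g, h, hinv, -⟩ := exists_skewPoint_inverse γ
  set X := p.1 * e + p.2 * g
  set Y := p.1 * f + p.2 * h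
  have hM' : (0 : ℤ) < M := by exact_mod_cast hM
  have hK' : (0 : ℤ) < K := by exact_mod_cast hK
  have hy0 := Int.emod_nonneg Y hK'.ne'
  have hy1 := Int.emod_lt_of_pos Y hK'
  have hx0 := Int.emod_nonneg (X - L * (Y / K)) hM'.ne'
  have hx1 := Int.emod_lt_of_pos (X - L * (Y / K)) hM'
  refine ⟨((X - L * (Y / K)) % M).toNat, (Y % K).toNat, by omega, by omega, fun U hU => ?_⟩
  rw [Int.toNat_of_nonneg hx0, Int.toNat_of_nonneg hy0]
  rw [← hU.2 _ ((X - L * (Y / K)) / M) (Y / K)]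
  congr 1
  refine Eq.trans ?_ (hinv p)
  have d1 := Int.mul_ediv_add_emod (X - L * (Y / K)) M
  have d2 := Int.mul_ediv_add_emod Y K
  set x := (X - L * (Y / K)) % M
  set s := (X - L * (Y / K)) / M
  set y := Y % K
  set t := Y / K
  simp only [skewPoint, Prod.mk_add_mk, Prod.mk.injEq]
  constructor
  · linear_combination (γ.1 0 0) * d1 + (γ.1 1 0) * d2
  · linear_combination (γ.1 0 1) * d1 + (γ.1 1 1) * d2

theorem finite_periodicPatterns {r N : ℕ} (B : Set (LocalPattern r N))
    (γ : Matrix.GeneralLinearGroup (Fin 2) ℤ) {M K : ℕ} (hM : 1 ≤ M) (hK : 1 ≤ K) (L : ℕ) :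
    (periodicPatterns B γ M L K).Finite := by
  refine Set.Finite.of_finite_image
    (f := fun U => fun q : Fin M × Fin K => U (skewPoint γ (q.1 : ℕ) (q.2 : ℕ)))
    (Set.toFinite _) ?_
  intro U hU U' hU' h
  funext p
  obtain ⟨x, y, hx, hy, hxy⟩ := exists_skewPoint_eq_of_periodic B γ hM hK L p
  rw [← hxy U hU, ← hxy U' hU']
  exact congrFun h (⟨x, hx⟩, ⟨y, hy⟩)

/-- A periodic pattern is determined by its restrictions to the `Q` squares of a tiling that meet a
fundamental parallelogram, and these squares lie in a neighbourhood of it whose width does not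
depend on the lattice. -/
theorem exists_ncard_periodicPatterns_le (γ : Matrix.GeneralLinearGroup (Fin 2) ℤ) :
    ∃ c : ℕ, ∀ {r N : ℕ} (B : Set (LocalPattern r N)) {n M K : ℕ}, 1 ≤ n → 1 ≤ M → 1 ≤ K →
      ∀ L : ℕ, ∃ Q : ℕ, Q * (n * n) ≤ (M + 2 * (c * n)) * (K + 2 * (c * n)) ∧
        (periodicPatterns B γ M L K).ncard ≤ (admissiblePatterns B n n).ncard ^ Q := by
  classical
  obtain ⟨e, f, g, h, hinv, hinv'⟩ := exists_skewPoint_inverse γ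
  refine ⟨e.natAbs + f.natAbs + g.natAbs + h.natAbs, fun {r N} B {n M K} hn hM hK L => ?_⟩
  set c := e.natAbs + f.natAbs + g.natAbs + h.natAbs with hc
  have hn' : (0 : ℤ) < n := by exact_mod_cast hn
  set Q : Finset (ℤ × ℤ) := (Finset.range M ×ˢ Finset.range K).image fun q =>
    ((skewPoint γ q.1 q.2).1 / (n : ℤ), (skewPoint γ q.1 q.2).2 / (n : ℤ)) with hQ
  refine ⟨Q.card, ?_, ?_⟩
  · have hcard : ((Q ×ˢ (Finset.range n ×ˢ Finset.range n))).card ≤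
        (Finset.Ico (-(c * n : ℤ)) (M + c * n) ×ˢ Finset.Ico (-(c * n : ℤ)) (K + c * n)).card := by
      refine Finset.card_le_card_of_injOn (fun z =>
        ((n * z.1.1 + z.2.1) * e + (n * z.1.2 + z.2.2) * g,
          (n * z.1.1 + z.2.1) * f + (n * z.1.2 + z.2.2) * h)) ?_ ?_
      · rintro ⟨⟨q1, q2⟩, ⟨i, j⟩⟩ hz
        simp only [Finset.coe_product, Set.mem_prod, Finset.mem_coe, Finset.mem_range, hQ,
          Finset.mem_image, Finset.mem_product, Prod.mk.injEq] at hz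
        obtain ⟨⟨⟨x, y⟩, ⟨hx, hy⟩, hq1, hq2⟩, hi, hj⟩ := hz
        simp only at hx hy hq1 hq2
        obtain ⟨hX, hY⟩ := hinv' x y
        set P := skewPoint γ x y
        have d1 : |n * q1 + i - P.1| ≤ (n : ℤ) := by
          have := Int.mul_ediv_add_emod P.1 n
          have := Int.emod_nonneg P.1 hn'.ne'
          have := Int.emod_lt_of_pos P.1 hn'
          rw [← hq1, abs_le]
          constructor <;> omega
        have d2 : |n * q2 + j - P.2| ≤ (n : ℤ) := by
          have := Int.mul_ediv_add_emod P.2 n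
          have := Int.emod_nonneg P.2 hn'.ne'
          have := Int.emod_lt_of_pos P.2 hn'
          rw [← hq2, abs_le]
          constructor <;> omega
        have bound : ∀ a b : ℤ, |a| + |b| ≤ c →
            |(n * q1 + i - P.1) * a + (n * q2 + j - P.2) * b| ≤ c * n := by
          intro a b hab
          calc _ ≤ |(n * q1 + i - P.1) * a| + |(n * q2 + j - P.2) * b| := abs_add_le _ _
            _ ≤ n * |a| + n * |b| := by
                rw [abs_mul, abs_mul]
                gcongr
            _ = (|a| + |b|) * n := by ring
            _ ≤ c * n := by gcongr
        have b1 := abs_le.mp (bound e g (by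
          rw [hc]
          push_cast
          linarith [abs_nonneg f, abs_nonneg h]))
        have b2 := abs_le.mp (bound f h (by
          rw [hc]
          push_cast
          linarith [abs_nonneg e, abs_nonneg g]))
        have hx' : (x : ℤ) + 1 ≤ M := by exact_mod_cast hx
        have hy' : (y : ℤ) + 1 ≤ K := by exact_mod_cast hy
        have hx0 : (0 : ℤ) ≤ x := by positivity
        have hy0 : (0 : ℤ) ≤ y := by positivity
        simp only [Finset.coe_product, Set.mem_prod, Finset.coe_Ico, Set.mem_Ico]
        refine ⟨⟨?_, ?_⟩, ?_, ?_⟩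
        · linarith [b1.1]
        · linarith [b1.2]
        · linarith [b2.1]
        · linarith [b2.2]
      · rintro ⟨⟨q1, q2⟩, ⟨i, j⟩⟩ hz ⟨⟨q1', q2'⟩, ⟨i', j'⟩⟩ hz' heq
        simp only [Finset.coe_product, Set.mem_prod, Finset.mem_coe, Finset.mem_range] at hz hz'
        simp only [Prod.mk.injEq] at heq
        have hp := hinv (n * q1 + i, n * q2 + j)
        simp only at hp
        rw [heq.1, heq.2] at hp
        have hp' := hinv (n * q1' + i', n * q2' + j')
        simp only at hp'
        rw [hp, Prod.mk.injEq] at hp'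
        have uniq : ∀ (a a' : ℤ) (s s' : ℕ), s < n → s' < n → (n : ℤ) * a + s = n * a' + s' →
            a = a' ∧ s = s' := by
          intro a a' s s' hs hs' h
          have h1 : ∀ (a : ℤ) (s : ℕ), s < n → ((n : ℤ) * a + s) / n = a := by
            intro a s hs
            rw [Int.mul_add_ediv_left _ _ hn'.ne',
              Int.ediv_eq_zero_of_lt (by positivity) (by exact_mod_cast hs), add_zero]
          have h2 : a = a' := by
            rw [← h1 a s hs, h, h1 a' s' hs']
          subst h2
          exact ⟨rfl, by omega⟩
        obtain ⟨r1, r2⟩ := uniq _ _ _ _ hz.2.1 hz'.2.1 hp'.1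
        obtain ⟨r3, r4⟩ := uniq _ _ _ _ hz.2.2 hz'.2.2 hp'.2
        subst r1 r2 r3 r4
        rfl
    rw [Finset.card_product, Finset.card_product, Finset.card_product, Finset.card_range,
      Int.card_Ico, Int.card_Ico] at hcard
    refine hcard.trans (le_of_eq ?_)
    congr 1
    · have : ((M : ℤ) + c * n - -(c * n)) = ((M + 2 * (c * n) : ℕ) : ℤ) := by push_cast; ring
      rw [this, Int.toNat_natCast]
    · have : ((K : ℤ) + c * n - -(c * n)) = ((K + 2 * (c * n) : ℕ) : ℤ) := by push_cast; ring
      rw [this, Int.toNat_natCast]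
  · have hmem : ∀ U ∈ periodicPatterns B γ M L K, ∀ q : ℤ × ℤ,
        (fun i j : Fin n => U (n * q.1 + (i : ℕ), n * q.2 + (j : ℕ))) ∈
          admissiblePatterns B n n := by
      intro U hU q i j hi hj
      have := hU.1 (n * q.1 + i) (n * q.2 + j)
      simpa only [Nat.cast_add, add_assoc] using this
    let Φ : periodicPatterns B γ M L K → Q → admissiblePatterns B n n :=
      fun U q => ⟨_, hmem U.1 U.2 q.1⟩
    have hΦ : Function.Injective Φ := by
      rintro ⟨U, hU⟩ ⟨U', hU'⟩ hUU
      ext1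
      funext p
      obtain ⟨x, y, hx, hy, hxy⟩ := exists_skewPoint_eq_of_periodic B γ hM hK L p
      change U p = U' p
      rw [← hxy U hU, ← hxy U' hU']
      set P := skewPoint γ x y with hP
      have hq : (P.1 / (n : ℤ), P.2 / (n : ℤ)) ∈ Q := by
        rw [hQ, Finset.mem_image]
        exact ⟨(x, y), by simp [hx, hy], rfl⟩
      have h1 := congrArg Subtype.val (congrFun hUU ⟨_, hq⟩)
      have m1 := Int.emod_nonneg P.1 hn'.ne'
      have m2 := Int.emod_lt_of_pos P.1 hn'
      have m3 := Int.emod_nonneg P.2 hn'.ne'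
      have m4 := Int.emod_lt_of_pos P.2 hn'
      have h2 := congrFun (congrFun h1 ⟨(P.1 % n).toNat, by omega⟩) ⟨(P.2 % n).toNat, by omega⟩
      simp only [Φ, Int.toNat_of_nonneg m1, Int.toNat_of_nonneg m3, Int.mul_ediv_add_emod] at h2
      exact h2
    have := Nat.card_le_card_of_injective Φ hΦ
    rwa [Nat.card_fun, Nat.card_eq_fintype_card (α := Q), Fintype.card_coe] at this

/-! ### The spatial entropy -/

theorem log_natCast_div_eq_coe {n : ℕ} (hn : n ≠ 0) (a b : ℕ) :
    ENNReal.log (n : ENNReal) / ((a : EReal) * (b : EReal)) =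
      ((Real.log n / ((a : ℝ) * b) : ℝ) : EReal) := by
  rw [← ENNReal.ofReal_natCast, ENNReal.log_ofReal_of_pos (by positivity), EReal.coe_div,
    EReal.coe_mul, EReal.coe_natCast, EReal.coe_natCast]

theorem log_zero_div_eq_bot {a b : ℕ} (ha : 1 ≤ a) (hb : 1 ≤ b) :
    ENNReal.log ((0 : ℕ) : ENNReal) / ((a : EReal) * (b : EReal)) = ⊥ := by
  have h : (a : EReal) * (b : EReal) = ((a * b : ℝ) : EReal) := by
    rw [EReal.coe_mul, EReal.coe_natCast, EReal.coe_natCast]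
  rw [Nat.cast_zero, ENNReal.log_zero, h]
  refine EReal.bot_div_of_pos_ne_top ?_ (EReal.coe_ne_top _)
  have : (0 : ℝ) < a * b := by positivity
  exact_mod_cast this

theorem eventually_one_le_prod : ∀ᶠ q : ℕ × ℕ in atTop ×ˢ atTop, 1 ≤ q.1 ∧ 1 ≤ q.2 :=
  (eventually_ge_atTop 1).prod_mk (eventually_ge_atTop 1)

theorem tendsto_patternRate_bot {r N : ℕ} (B : Set (LocalPattern r N)) {n k : ℕ}
    (h : (admissiblePatterns B n k).ncard = 0) :
    Tendsto (patternRate B) (atTop ×ˢ atTop) (𝓝 ⊥) := by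
  refine tendsto_nhds_of_eventually_eq ?_
  have hge : ∀ᶠ q : ℕ × ℕ in atTop ×ˢ atTop, n ≤ q.1 ∧ k ≤ q.2 :=
    (eventually_ge_atTop n).prod_mk (eventually_ge_atTop k)
  filter_upwards [hge, eventually_one_le_prod] with q hq hq1
  have h0 : (admissiblePatterns B q.1 q.2).ncard = 0 := by
    obtain ⟨n', hn'⟩ := Nat.exists_eq_add_of_le hq.1
    obtain ⟨k', hk'⟩ := Nat.exists_eq_add_of_le hq.2
    rw [hn', hk']
    refine Nat.le_zero.mp ((ncard_admissiblePatterns_add_left_le B n n' _).trans ?_)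
    refine (Nat.mul_le_mul_right _ (ncard_admissiblePatterns_add_right_le B n k k')).trans ?_
    simp [h]
  rw [patternRate, h0, log_zero_div_eq_bot hq1.1 hq1.2]

theorem exists_tendsto_log_ncard_div {r N : ℕ} (B : Set (LocalPattern r N))
    (hB : ∀ n k, (admissiblePatterns B n k).ncard ≠ 0) :
    ∃ h : ℝ, 0 ≤ h ∧
      (∀ n k : ℕ, h * (n * k) ≤ Real.log (admissiblePatterns B n k).ncard) ∧
      Tendsto (fun q : ℕ × ℕ => Real.log (admissiblePatterns B q.1 q.2).ncard /
        ((q.1 : ℝ) * q.2)) (atTop ×ˢ atTop) (𝓝 h) := by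
  have hpos : ∀ n k, (0 : ℝ) < (admissiblePatterns B n k).ncard := fun n k =>
    Nat.cast_pos.mpr (Nat.pos_of_ne_zero (hB n k))
  refine exists_tendsto_div_of_subadditive
    (fun n k => Real.log (admissiblePatterns B n k).ncard) (Real.log r)
    (fun n k => Real.log_natCast_nonneg _) ?_ ?_ ?_
  · intro n k
    have h1 : ((admissiblePatterns B n k).ncard : ℝ) ≤ (r : ℝ) ^ (n * k) := by
      exact_mod_cast ncard_admissiblePatterns_le B n k
    refine (Real.log_le_log (hpos n k) h1).trans (le_of_eq ?_)
    rw [Real.log_pow]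
    push_cast
    ring
  · intro n n' k
    rw [← Real.log_mul (hpos n k).ne' (hpos n' k).ne']
    exact Real.log_le_log (hpos _ _)
      (by exact_mod_cast ncard_admissiblePatterns_add_left_le B n n' k)
  · intro n k k'
    rw [← Real.log_mul (hpos n k).ne' (hpos n k').ne']
    exact Real.log_le_log (hpos _ _)
      (by exact_mod_cast ncard_admissiblePatterns_add_right_le B n k k')

theorem tendsto_patternRate_coe {r N : ℕ} (B : Set (LocalPattern r N))
    (hB : ∀ n k, (admissiblePatterns B n k).ncard ≠ 0) {h : ℝ}
    (hlim : Tendsto (fun q : ℕ × ℕ => Real.log (admissiblePatterns B q.1 q.2).ncard /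
        ((q.1 : ℝ) * q.2)) (atTop ×ˢ atTop) (𝓝 h)) :
    Tendsto (patternRate B) (atTop ×ˢ atTop) (𝓝 (h : EReal)) := by
  refine ((continuous_coe_real_ereal.tendsto h).comp hlim).congr fun q => ?_
  rw [patternRate, log_natCast_div_eq_coe (hB _ _)]
  rfl

theorem tendsto_patternRate {r N : ℕ} (B : Set (LocalPattern r N)) :
    Tendsto (patternRate B) (atTop ×ˢ atTop) (𝓝 (spatialEntropy B)) := by
  by_cases hB : ∀ n k, (admissiblePatterns B n k).ncard ≠ 0
  · obtain ⟨h, -, -, hlim⟩ := exists_tendsto_log_ncard_div B hB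
    have := tendsto_patternRate_coe B hB hlim
    rwa [spatialEntropy, this.limsup_eq]
  · push Not at hB
    obtain ⟨n, k, h⟩ := hB
    have := tendsto_patternRate_bot B h
    rwa [spatialEntropy, this.limsup_eq]

/-! ### The periodic entropy is at most the spatial entropy -/

theorem skewPeriodicEntropy_le_spatialEntropy {r N : ℕ} (B : Set (LocalPattern r N))
    (γ : Matrix.GeneralLinearGroup (Fin 2) ℤ) : skewPeriodicEntropy B γ ≤ spatialEntropy B := by
  by_cases hB : ∀ n k, (admissiblePatterns B n k).ncard ≠ 0
  · obtain ⟨h, h0, hle, hlim⟩ := exists_tendsto_log_ncard_div B hB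
    have hs : spatialEntropy B = (h : EReal) := (tendsto_patternRate_coe B hB hlim).limsup_eq
    rw [hs, ← EReal.le_of_forall_lt_iff_le]
    intro z hz
    have hz' : h < z := by exact_mod_cast hz
    -- A square whose pattern count is already close to optimal.
    have hdiag := hlim.comp (tendsto_id.prodMk tendsto_id : Tendsto (fun n : ℕ => (n, n)) atTop _)
    obtain ⟨n, hn, hn1⟩ :=
      ((hdiag.eventually (gt_mem_nhds hz')).and (eventually_ge_atTop 1)).exists
    simp only [Function.comp_apply, id] at hn
    set a := Real.log (admissiblePatterns B n n).ncard with ha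
    have ha0 : 0 ≤ a := Real.log_natCast_nonneg _
    obtain ⟨c, hc⟩ := exists_ncard_periodicPatterns_le γ
    have hone : Tendsto (fun q : ℕ × ℕ => (1 + 2 * (c * n) / (q.1 : ℝ)) *
        (1 + 2 * (c * n) / (q.2 : ℝ)) * (a / ((n : ℝ) * n))) (atTop ×ˢ atTop)
        (𝓝 ((1 + 0) * (1 + 0) * (a / ((n : ℝ) * n)))) := by
      refine Tendsto.mul_const _ (Tendsto.mul ?_ ?_)
      · exact tendsto_const_nhds.add
          ((tendsto_const_div_atTop_nhds_zero_nat (2 * (c * n : ℝ))).comp tendsto_fst)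
      · exact tendsto_const_nhds.add
          ((tendsto_const_div_atTop_nhds_zero_nat (2 * (c * n : ℝ))).comp tendsto_snd)
    rw [add_zero, one_mul, one_mul] at hone
    refine limsup_le_of_le (h := ?_)
    filter_upwards [hone.eventually (gt_mem_nhds hn), eventually_one_le_prod] with q hq hq1
    refine iSup_le fun L => ?_
    rcases Nat.eq_zero_or_pos (periodicPatterns B γ q.1 L q.2).ncard with hΓ | hΓ
    · rw [hΓ, log_zero_div_eq_bot hq1.1 hq1.2]
      exact bot_le
    rw [log_natCast_div_eq_coe hΓ.ne']
    refine EReal.coe_le_coe_iff.mpr (le_trans ?_ hq.le)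
    obtain ⟨Q, hQ, hQΓ⟩ := hc B hn1 hq1.1 hq1.2 L
    have hM : (0 : ℝ) < q.1 := by exact_mod_cast hq1.1
    have hK : (0 : ℝ) < q.2 := by exact_mod_cast hq1.2
    have hnp : (0 : ℝ) < n := by exact_mod_cast hn1
    have e1 : Real.log (periodicPatterns B γ q.1 L q.2).ncard ≤ Q * a := by
      rw [ha, ← Real.log_pow]
      exact Real.log_le_log (by exact_mod_cast hΓ) (by exact_mod_cast hQΓ)
    have e2 : (Q : ℝ) * (n * n) ≤ (q.1 + 2 * (c * n)) * (q.2 + 2 * (c * n)) := by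
      exact_mod_cast hQ
    rw [div_le_iff₀ (by positivity)]
    calc _ ≤ Q * a := e1
      _ = (Q * (n * n)) * (a / ((n : ℝ) * n)) := by field_simp
      _ ≤ ((q.1 + 2 * (c * n)) * (q.2 + 2 * (c * n))) * (a / ((n : ℝ) * n)) := by gcongr
      _ = _ := by field_simp
  · push Not at hB
    obtain ⟨n, k, h⟩ := hB
    refine le_trans ?_ bot_le
    refine limsup_le_of_le (h := ?_)
    filter_upwards [eventually_one_le_prod] with q hq1
    refine iSup_le fun L => ?_
    have hempty : periodicPatterns B γ q.1 L q.2 = ∅ := by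
      rw [Set.eq_empty_iff_forall_notMem]
      intro U hU
      rw [Set.ncard_eq_zero (Set.toFinite _)] at h
      refine (Set.eq_empty_iff_forall_notMem.mp h) (fun i j => U ((i : ℕ), (j : ℕ))) ?_
      intro i j hi hj
      have := hU.1 i j
      simpa only [Nat.cast_add] using this
    rw [hempty, Set.ncard_empty, log_zero_div_eq_bot hq1.1 hq1.2]

/-! ### The cylinder entropy is at most the periodic entropy -/

/-- For suitable `k`, the lattice `m ℤ × k ℤ` contains (in fact equals) a lattice in the normal form
relative to `γ`, of the same index and with both diagonal entries at least `m`. -/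
theorem exists_skew_sublattice (γ : Matrix.GeneralLinearGroup (Fin 2) ℤ) :
    ∃ b' : ℕ, 1 ≤ b' ∧ ∀ m j : ℕ, 1 ≤ m → 1 ≤ j → ∃ M L K : ℕ, m ≤ M ∧ m ≤ K ∧ L < M ∧
      M * K = m * (m * b' * j) ∧ ∀ s t : ℤ,
        (m : ℤ) ∣ (skewPoint γ (M * s + L * t) (K * t)).1 ∧
        ((m * b' * j : ℕ) : ℤ) ∣ (skewPoint γ (M * s + L * t) (K * t)).2 := by
  by_cases hb : γ.1 0 1 = 0
  · refine ⟨1, le_rfl, fun m j hm hj => ⟨m, 0, m * 1 * j, le_rfl, ?_, hm, rfl, fun s t => ?_⟩⟩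
    · nlinarith
    · simp only [skewPoint, hb]
      exact ⟨⟨s * γ.1 0 0 + j * t * γ.1 1 0, by push_cast; ring⟩,
        ⟨t * γ.1 1 1, by push_cast; ring⟩⟩
  · set b := γ.1 0 1 with hbdef
    set d := γ.1 1 1
    have hbpos : 1 ≤ b.natAbs := Int.natAbs_pos.mpr hb
    have hsgn : (b.natAbs : ℤ) = b.sign * b := by rw [Int.sign_mul_self_eq_abs, Int.abs_eq_natAbs]
    refine ⟨b.natAbs, hbpos, fun m j hm hj => ?_⟩
    have hMpos : 0 < ((m * j : ℕ) : ℤ) := by positivity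
    -- The exact solution of `L b + K d = 0`, to be reduced modulo `M`.
    set L₀ : ℤ := -(b.sign * m * d) with hL₀
    have hL0 := Int.emod_nonneg L₀ hMpos.ne'
    have hL1 := Int.emod_lt_of_pos L₀ hMpos
    refine ⟨m * j, (L₀ % ((m * j : ℕ) : ℤ)).toNat, m * b.natAbs, ?_, ?_, by omega, by ring,
      fun s t => ?_⟩
    · nlinarith
    · nlinarith
    · rw [Int.toNat_of_nonneg hL0, Int.emod_def]
      set w := L₀ / ((m * j : ℕ) : ℤ)
      simp only [skewPoint]
      push_cast
      rw [Int.abs_eq_natAbs, hsgn, hL₀]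
      constructor
      · refine ⟨(j * s + (-(b.sign * d) - j * w) * t) * γ.1 0 0 + b.sign * b * t * γ.1 1 0, ?_⟩
        ring
      · refine ⟨b.sign * s - b.sign * w * t, ?_⟩
        have hss : b.sign * b.sign = 1 := by
          rcases lt_or_gt_of_ne hb with h | h
          · rw [Int.sign_eq_neg_one_of_neg h]; norm_num
          · rw [Int.sign_eq_one_of_pos h]; norm_num
        linear_combination (-(m * j * b * (s - w * t))) * hss

theorem hasEigenvalue_maxEigenvalue {ι : Type} [Fintype ι] [DecidableEq ι] (A : Matrix ι ι ℝ)
    (h : 0 < maxEigenvalue A) : Module.End.HasEigenvalue (Matrix.toLin' A) (maxEigenvalue A) := by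
  have hne : {x : ℝ | Module.End.HasEigenvalue (Matrix.toLin' A) x}.Nonempty := by
    by_contra hne
    rw [Set.not_nonempty_iff_eq_empty] at hne
    rw [maxEigenvalue, hne, Real.sSup_empty] at h
    exact h.false
  exact hne.csSup_mem (Module.End.finite_hasEigenvalue _)

theorem cylinderEntropy_le_skewPeriodicEntropy {r N : ℕ} (hN : 2 ≤ N)
    (B : Set (LocalPattern r N)) (γ : Matrix.GeneralLinearGroup (Fin 2) ℤ) :
    cylinderEntropy B ≤ skewPeriodicEntropy B γ := by
  rw [← EReal.ge_of_forall_gt_iff_ge]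
  intro z hz
  have hfreq := frequently_lt_of_lt_limsup (h := hz)
  refine le_limsup_of_frequently_le' ?_
  rw [prod_atTop_atTop_eq, frequently_atTop]
  rintro ⟨M₀, K₀⟩
  obtain ⟨m, hm, hzm⟩ := frequently_atTop.mp hfreq (max 1 (max M₀ K₀))
  have hm1 : 1 ≤ m := (le_max_left _ _).trans hm
  have hmp : (0 : ℝ) < m := by exact_mod_cast hm1
  set T := transitionMatrix B m with hT
  set ρ := maxEigenvalue T with hρ
  have hρ0 : 0 < ρ := by
    by_contra hneg
    rw [ENNReal.ofReal_of_nonpos (not_lt.mp hneg), ENNReal.log_zero,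
      EReal.bot_div_of_pos_ne_top (by exact_mod_cast hm1) (EReal.natCast_ne_top m)] at hzm
    exact not_lt_bot hzm
  have hρz : Real.exp (z * m) < ρ := by
    rw [ENNReal.log_ofReal_of_pos hρ0, ← EReal.coe_natCast, ← EReal.coe_div,
      EReal.coe_lt_coe_iff, lt_div_iff₀ hmp] at hzm
    exact (Real.lt_log_iff_exp_lt hρ0).mp hzm
  obtain ⟨b', hb', hlat⟩ := exists_skew_sublattice γ
  have heig : Module.End.HasEigenvalue (Matrix.toLin' (T ^ (m * b'))) (ρ ^ (m * b')) := by
    rw [Matrix.toLin'_pow]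
    exact (hasEigenvalue_maxEigenvalue T hρ0).pow _
  obtain ⟨j, hj, htr⟩ := frequently_atTop.mp (frequently_pow_le_trace_pow_of_hasEigenvalue
    (T ^ (m * b')) heig (y := Real.exp (z * m) ^ (m * b')) (by positivity)
    (pow_lt_pow_left₀ hρz (Real.exp_pos _).le (by positivity))) 1
  obtain ⟨M, L, K, hmM, hmK, hLM, hMK, hdvd⟩ := hlat m j hm1 hj
  have hM1 : 1 ≤ M := hm1.trans hmM
  have hK1 : 1 ≤ K := hm1.trans hmK
  have hk1 : 1 ≤ m * b' * j := Nat.mul_pos (Nat.mul_pos hm1 hb') hj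
  rw [← pow_mul, ← pow_mul] at htr
  have hΓ := htr.trans (trace_transitionMatrix_le_ncard hN B hm1 hk1 (periodicPatterns B γ M L K)
    (finite_periodicPatterns B γ hM1 hK1 L)
    (fun U hU hper => ⟨hU, fun p s t => hper p _ (hdvd s t).1 (hdvd s t).2⟩))
  rw [← Real.exp_nat_mul] at hΓ
  have hpos : (0 : ℝ) < (periodicPatterns B γ M L K).ncard := (Real.exp_pos _).trans_le hΓ
  have hMr : (0 : ℝ) < M := by exact_mod_cast hM1
  have hKr : (0 : ℝ) < K := by exact_mod_cast hK1
  refine ⟨(M, K), ⟨?_, ?_⟩, ?_⟩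
  · exact ((le_max_left _ _).trans (le_max_right _ _)).trans (hm.trans hmM)
  · exact ((le_max_right _ _).trans (le_max_right _ _)).trans (hm.trans hmK)
  · refine le_trans ?_ (le_iSup _ (⟨L, hLM⟩ : Fin M))
    simp only
    rw [log_natCast_div_eq_coe (by exact_mod_cast hpos.ne')]
    rw [EReal.coe_le_coe_iff, le_div_iff₀ (by positivity)]
    refine le_trans (le_of_eq ?_) ((Real.le_log_iff_exp_le hpos).mpr hΓ)
    have : (M : ℝ) * K = m * (m * b' * j) := by exact_mod_cast hMK
    rw [this]
    push_cast
    ring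

/-! ### Uniform domination -/

/-- The sides of a strip of fixed height can be glued together at no cost to the exponential growth
rate, so that the strip yields many patterns on cylinders, which uniform domination bounds. -/
theorem spatialEntropy_le_cylinderEntropy {r N : ℕ} (hN : 2 ≤ N) (B : Set (LocalPattern r N))
    (hdom : UniformlyDominated B) : spatialEntropy B ≤ cylinderEntropy B := by
  by_cases hB : ∀ n k, (admissiblePatterns B n k).ncard ≠ 0
  swap
  · push Not at hB
    obtain ⟨n, k, h⟩ := hB
    rw [spatialEntropy, (tendsto_patternRate_bot B h).limsup_eq]
    exact bot_le
  obtain ⟨h, h0, hle, hlim⟩ := exists_tendsto_log_ncard_div B hB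
  have hs : spatialEntropy B = (h : EReal) := (tendsto_patternRate_coe B hB hlim).limsup_eq
  obtain ⟨c, hc, hclim⟩ := hdom
  rw [hs, ← EReal.ge_of_forall_gt_iff_ge]
  intro z hz
  have hz' : z < h := by exact_mod_cast hz
  obtain ⟨ε, hε, hεh⟩ : ∃ ε : ℝ, 0 < ε ∧ z + ε < h := ⟨(h - z) / 2, by linarith, by linarith⟩
  have hcε := hclim.eventually (gt_mem_nhds hε)
  rw [prod_atTop_atTop_eq, eventually_atTop] at hcε
  obtain ⟨⟨m₁, k₁⟩, hcε⟩ := hcε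
  -- An odd exponent forces the maximum eigenvalue to be positive.
  obtain ⟨k, hkk₁, hkodd, hk1⟩ : ∃ k : ℕ, k₁ ≤ k ∧ Odd k ∧ 1 ≤ k :=
    ⟨2 * k₁ + 1, by omega, ⟨k₁, rfl⟩, by omega⟩
  have hkr : (0 : ℝ) < k := by exact_mod_cast hk1
  have hgrow : ∀ n : ℕ, Real.exp (h * k) ^ n ≤ entrySum (stripMatrix B (k + (N - 1)) ^ n) := by
    intro n
    refine le_trans ?_ (ncard_admissiblePatterns_le_entrySum hN B n (k + (N - 1)))
    rw [← Real.exp_nat_mul]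
    have hpos : (0 : ℝ) < (admissiblePatterns B (n + (N - 1)) (k + (N - 1))).ncard :=
      Nat.cast_pos.mpr (Nat.pos_of_ne_zero (hB _ _))
    refine (Real.le_log_iff_exp_le hpos).mp (le_trans ?_ (hle _ _))
    have e1 : (n : ℝ) ≤ (n + (N - 1) : ℕ) := by exact_mod_cast Nat.le_add_right _ _
    have e2 : (k : ℝ) ≤ (k + (N - 1) : ℕ) := by exact_mod_cast Nat.le_add_right _ _
    calc (n : ℝ) * (h * k) = h * (n * k) := by ring
      _ ≤ _ := by gcongr
  refine le_limsup_of_frequently_le' (frequently_atTop.mpr fun m₀ => ?_)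
  obtain ⟨m, hm, htr⟩ := frequently_atTop.mp (frequently_pow_le_trace_pow_of_entrySum _ hgrow
    (y := Real.exp ((z + ε) * k)) (Real.exp_pos _)
    (Real.exp_lt_exp.mpr (by gcongr))) (max 1 (max m₀ m₁))
  have hm1 : 1 ≤ m := (le_max_left _ _).trans hm
  have hm₀ : m₀ ≤ m := ((le_max_left _ _).trans (le_max_right _ _)).trans hm
  have hm₁ : m₁ ≤ m := ((le_max_right _ _).trans (le_max_right _ _)).trans hm
  have hmr : (0 : ℝ) < m := by exact_mod_cast hm1
  refine ⟨m, hm₀, ?_⟩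
  obtain ⟨hcpos, hcle⟩ := hc m k hm1 hk1
  set ρ := maxEigenvalue (transitionMatrix B m)
  have hmain := (htr.trans (trace_stripMatrix_le_entrySum hN B hm1 k)).trans hcle
  rw [← Real.exp_nat_mul] at hmain
  have hρk : 0 < ρ ^ k := pos_of_mul_pos_right ((Real.exp_pos _).trans_le hmain) hcpos.le
  have hρ : 0 < ρ := hkodd.pow_pos_iff.mp hρk
  have hlog := (Real.le_log_iff_exp_le (by positivity)).mpr hmain
  rw [Real.log_mul hcpos.ne' hρk.ne', Real.log_pow] at hlog
  have hclog := hcε (m, k) ⟨hm₁, hkk₁⟩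
  simp only at hclog
  rw [div_lt_iff₀ (by positivity)] at hclog
  rw [ENNReal.log_ofReal_of_pos hρ, ← EReal.coe_natCast, ← EReal.coe_div,
    EReal.coe_le_coe_iff, le_div_iff₀ hmr]
  refine le_of_mul_le_mul_right ?_ hkr
  linarith

theorem theorem1p5 (r N : ℕ) (hr : 2 ≤ r) (hN : 2 ≤ N) (B : Set (LocalPattern r N)) :
    Tendsto (patternRate B) (atTop ×ˢ atTop) (𝓝 (spatialEntropy B)) ∧
    (spatialEntropy B = cylinderEntropy B →
      ∀ γ : Matrix.GeneralLinearGroup (Fin 2) ℤ,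
        skewPeriodicEntropy B γ = spatialEntropy B) ∧
    (UniformlyDominated B →
      ∀ γ : Matrix.GeneralLinearGroup (Fin 2) ℤ,
        skewPeriodicEntropy B γ = spatialEntropy B) := by
  refine ⟨tendsto_patternRate B, fun h γ => ?_, fun h γ => ?_⟩
  · exact le_antisymm (skewPeriodicEntropy_le_spatialEntropy B γ)
      (h.trans_le (cylinderEntropy_le_skewPeriodicEntropy hN B γ))
  · exact le_antisymm (skewPeriodicEntropy_le_spatialEntropy B γ)
      ((spatialEntropy_le_cylinderEntropy hN B h).trans
        (cylinderEntropy_le_skewPeriodicEntropy hN B γ))
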